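/- Let $P_n$ denote the path graph on $n$ vertices and let $P_r \,\square\, P_s$ be the Cartesian product of two paths (the $r\times s$ grid graph). A geodesic of a graph is a shortest path between its end vertices. A set $S$ of edges of a finite graph $G$ is an edge general position set if no geodesic of $G$ contains three edges of $S$, and the edge general position number $\mathrm{gp_e}(G)$ is the maximum cardinality of an edge general position set of $G$. If $r \ge s \ge 2$, then $$\mathrm{gp_e}(P_r \,\square\, P_s) = \begin{cases} r+2, & s = 2,\\ 2r, & s = 3,\\ 2r+2s-8, & s \ge 4. \end{cases}$$ -/

import Mathlib

namespace SimpleGraph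

variable {V : Type*}

/-- A walk is a geodesic (shortest path, isometric path) if its number of edges equals the
distance between its end vertices. -/
def Walk.IsGeodesic {G : SimpleGraph V} {u v : V} (p : G.Walk u v) : Prop :=
  p.length = G.dist u v

/-- A set `S` of edges of `G` is an edge general position set if no geodesic of `G` contains three
(distinct) edges of `S`. -/
def IsEdgeGeneralPosition (G : SimpleGraph V) (S : Finset (Sym2 V)) : Prop :=
  (∀ e ∈ S, e ∈ G.edgeSet) ∧
    ∀ (u v : V) (p : G.Walk u v), p.IsGeodesic →
      ¬ ∃ e ∈ S, ∃ f ∈ S, ∃ g ∈ S, e ≠ f ∧ e ≠ g ∧ f ≠ g ∧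
        e ∈ p.edges ∧ f ∈ p.edges ∧ g ∈ p.edges

/-- The edge general position number of a finite graph: the maximum cardinality of an edge general
position set. (The set below is nonempty and bounded, because `V` is finite.) -/
noncomputable def edgeGeneralPositionNumber [Finite V] (G : SimpleGraph V) : ℕ :=
  sSup {n : ℕ | ∃ S : Finset (Sym2 V), G.IsEdgeGeneralPosition S ∧ S.card = n}

end SimpleGraph

/-! In a grid, distance is taxicab distance, so every geodesic is a staircase, monotone in each
coordinate.

Upper bound: each staircase carries at most two edges of `S` (`route_le_two`). Count `S` by rows and
columns (`card_le_sum`). An inner line carries at most 2 edges, or 1 if it is a rung of the two-row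
grid. The few lines near the boundary are bounded together, by averaging over staircases that cover
them evenly.

Lower bound: take Φ, Ψ with values in {0, 1, 2}, Φ monotone towards the upper right and Ψ towards
the lower right. A geodesic, suitably oriented, has one of them nondecreasing along it, so it has at
most two edges where that function changes. Any set of edges along which both change is therefore in
edge general position. -/

namespace SimpleGraph

/-! ### Routes, distance and edge counts in the grid -/

/-- The grid graph with `r` columns and `s` rows. -/
abbrev grid (r s : ℕ) : SimpleGraph (Fin r × Fin s) := pathGraph r □ pathGraph s

/-- The integer coordinates of a vertex of the grid. -/
def gridCoord {r s : ℕ} (u : Fin r × Fin s) : ℕ × ℕ := (u.1, u.2)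

/-- The taxicab distance on `ℕ × ℕ`. -/
def taxicabDist (a b : ℕ × ℕ) : ℕ := (a.1 - b.1) + (b.1 - a.1) + ((a.2 - b.2) + (b.2 - a.2))

lemma gridCoord_injective {r s : ℕ} :
    Function.Injective (gridCoord : Fin r × Fin s → ℕ × ℕ) := by
  rintro ⟨a, b⟩ ⟨c, d⟩ h
  simp only [gridCoord, Prod.mk.injEq] at h
  exact Prod.ext (Fin.ext h.1) (Fin.ext h.2)

lemma grid_adj {r s : ℕ} {u v : Fin r × Fin s} :
    (grid r s).Adj u v ↔
      ((u.1.val + 1 = v.1.val ∨ v.1.val + 1 = u.1.val) ∧ u.2.val = v.2.val) ∨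
      ((u.2.val + 1 = v.2.val ∨ v.2.val + 1 = u.2.val) ∧ u.1.val = v.1.val) := by
  simp only [boxProd_adj, pathGraph_adj, Fin.ext_iff]

lemma taxicabDist_le_length {r s : ℕ} {u v : Fin r × Fin s} (p : (grid r s).Walk u v) :
    taxicabDist (gridCoord u) (gridCoord v) ≤ p.length := by
  induction p with
  | nil => simp [taxicabDist]
  | cons h p ih =>
    rw [grid_adj] at h
    simp only [taxicabDist, gridCoord, Walk.length_cons] at ih ⊢
    omega

/-- `GridRoute r s T a b n` says that some walk of the `r × s` grid from `a` to `b` has taxicab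
length and contains exactly `n` edges of `T`. -/
def GridRoute (r s : ℕ) (T : Finset (Sym2 (ℕ × ℕ))) (a b : ℕ × ℕ) (n : ℕ) : Prop :=
  ∃ (u v : Fin r × Fin s) (p : (grid r s).Walk u v), gridCoord u = a ∧ gridCoord v = b ∧
    p.length = taxicabDist a b ∧ (p.edges.map (Sym2.map gridCoord)).countP (· ∈ T) = n

/-- The number of edges of `T` in row `j` between columns `a` and `b`. -/
def rowCount (T : Finset (Sym2 (ℕ × ℕ))) (j a b : ℕ) : ℕ :=
  ∑ k ∈ Finset.Ico a b, if s((k, j), (k + 1, j)) ∈ T then 1 else 0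

/-- The number of edges of `T` in column `i` between rows `a` and `b`. -/
def colCount (T : Finset (Sym2 (ℕ × ℕ))) (i a b : ℕ) : ℕ :=
  ∑ k ∈ Finset.Ico a b, if s((i, k), (i, k + 1)) ∈ T then 1 else 0

lemma rowCount_add (T : Finset (Sym2 (ℕ × ℕ))) (j : ℕ) {a b c : ℕ} (h : a ≤ b) (h' : b ≤ c) :
    rowCount T j a b + rowCount T j b c = rowCount T j a c :=
  Finset.sum_Ico_consecutive _ h h'

lemma colCount_add (T : Finset (Sym2 (ℕ × ℕ))) (i : ℕ) {a b c : ℕ} (h : a ≤ b) (h' : b ≤ c) :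
    colCount T i a b + colCount T i b c = colCount T i a c :=
  Finset.sum_Ico_consecutive _ h h'

namespace GridRoute

variable {r s : ℕ} {T : Finset (Sym2 (ℕ × ℕ))} {a b c : ℕ × ℕ} {m n : ℕ}

lemma append (h : GridRoute r s T a b m) (h' : GridRoute r s T b c n)
    (hd : taxicabDist a c = taxicabDist a b + taxicabDist b c) : GridRoute r s T a c (m + n) := by
  obtain ⟨u, v, p, rfl, rfl, hp, rfl⟩ := h
  obtain ⟨v', w, q, hv, rfl, hq, rfl⟩ := h'
  obtain rfl := gridCoord_injective hv
  exact ⟨u, w, p.append q, rfl, rfl, by rw [Walk.length_append, hp, hq, hd], by simp⟩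

lemma reverse (h : GridRoute r s T a b n) : GridRoute r s T b a n := by
  obtain ⟨u, v, p, rfl, rfl, hp, rfl⟩ := h
  refine ⟨v, u, p.reverse, rfl, rfl, ?_, by simp⟩
  rw [Walk.length_reverse, hp]
  simp only [taxicabDist]
  omega

lemma refl {i j : ℕ} (hi : i < r) (hj : j < s) : GridRoute r s T (i, j) (i, j) 0 :=
  ⟨(⟨i, hi⟩, ⟨j, hj⟩), _, Walk.nil, rfl, rfl, by simp [taxicabDist], by simp⟩

lemma right {j x y : ℕ} (hj : j < s) (hy : y < r) (hxy : x ≤ y) :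
    GridRoute r s T (x, j) (y, j) (rowCount T j x y) := by
  induction y, hxy using Nat.le_induction with
  | base => simpa [rowCount] using refl hy hj
  | succ y hxy ih =>
    have key : GridRoute r s T (y, j) (y + 1, j) (if s((y, j), (y + 1, j)) ∈ T then 1 else 0) :=
      ⟨(⟨y, by omega⟩, ⟨j, hj⟩), (⟨y + 1, hy⟩, ⟨j, hj⟩), Walk.cons (by simp [pathGraph_adj]) Walk.nil,
        rfl, rfl, by simp [taxicabDist], by simp [gridCoord, List.countP_cons]⟩
    have := append (ih (by omega)) key (by simp only [taxicabDist]; omega)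
    rwa [rowCount, Finset.sum_Ico_succ_top hxy]

lemma up {i x y : ℕ} (hi : i < r) (hy : y < s) (hxy : x ≤ y) :
    GridRoute r s T (i, x) (i, y) (colCount T i x y) := by
  induction y, hxy using Nat.le_induction with
  | base => simpa [colCount] using refl hi hy
  | succ y hxy ih =>
    have key : GridRoute r s T (i, y) (i, y + 1) (if s((i, y), (i, y + 1)) ∈ T then 1 else 0) :=
      ⟨(⟨i, hi⟩, ⟨y, by omega⟩), (⟨i, hi⟩, ⟨y + 1, hy⟩), Walk.cons (by simp [pathGraph_adj]) Walk.nil,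
        rfl, rfl, by simp [taxicabDist], by simp [gridCoord, List.countP_cons]⟩
    have := append (ih (by omega)) key (by simp only [taxicabDist]; omega)
    rwa [colCount, Finset.sum_Ico_succ_top hxy]

lemma down {i x y : ℕ} (hi : i < r) (hy : y < s) (hxy : x ≤ y) :
    GridRoute r s T (i, y) (i, x) (colCount T i x y) :=
  (up hi hy hxy).reverse

end GridRoute

lemma grid_dist {r s : ℕ} (u v : Fin r × Fin s) :
    (grid r s).dist u v = taxicabDist (gridCoord u) (gridCoord v) := by
  have key : ∃ p : (grid r s).Walk u v,
      p.length = taxicabDist (gridCoord u) (gridCoord v) := by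
    -- Only the length of the L-shaped route matters here, so `T` is empty.
    have h₁ : ∃ n, GridRoute r s ∅ (gridCoord u) (v.1, u.2) n := by
      rcases le_total u.1.val v.1.val with h | h
      · exact ⟨_, GridRoute.right u.2.2 v.1.2 h⟩
      · exact ⟨_, (GridRoute.right u.2.2 u.1.2 h).reverse⟩
    have h₂ : ∃ n, GridRoute r s ∅ (v.1, u.2) (gridCoord v) n := by
      rcases le_total u.2.val v.2.val with h | h
      · exact ⟨_, GridRoute.up v.1.2 v.2.2 h⟩
      · exact ⟨_, GridRoute.down v.1.2 u.2.2 h⟩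
    obtain ⟨m, h₁⟩ := h₁
    obtain ⟨n, h₂⟩ := h₂
    obtain ⟨u', v', p, hu, hv, hp, -⟩ :=
      h₁.append h₂ (by simp only [taxicabDist, gridCoord]; omega)
    obtain rfl := gridCoord_injective hu
    obtain rfl := gridCoord_injective hv
    exact ⟨p, hp⟩
  obtain ⟨p, hp⟩ := key
  obtain ⟨q, hq⟩ := p.reachable.exists_walk_length_eq_dist
  exact le_antisymm (hp ▸ dist_le p) (hq ▸ taxicabDist_le_length q)

/-- A set of edges of the grid, in integer coordinates. -/
def coordEdges {r s : ℕ} (S : Finset (Sym2 (Fin r × Fin s))) : Finset (Sym2 (ℕ × ℕ)) :=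
  S.image (Sym2.map gridCoord)

/-- A route is a geodesic, hence a path without repeated edges, so its count with multiplicity is a
count of distinct edges of `S`. -/
lemma IsEdgeGeneralPosition.route_le_two {r s : ℕ} {S : Finset (Sym2 (Fin r × Fin s))}
    (hS : (grid r s).IsEdgeGeneralPosition S) {a b : ℕ × ℕ} {n : ℕ}
    (h : GridRoute r s (coordEdges S) a b n) : n ≤ 2 := by
  classical
  obtain ⟨u, v, p, rfl, rfl, hp, rfl⟩ := h
  rw [← grid_dist] at hp
  have hnd : p.edges.Nodup := (p.isPath_of_length_eq_dist hp).isTrail.edges_nodup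
  have hmem (e : Sym2 (Fin r × Fin s)) : Sym2.map gridCoord e ∈ coordEdges S ↔ e ∈ S := by
    rw [coordEdges, Finset.mem_image]
    exact ⟨fun ⟨f, hf, he⟩ ↦ Sym2.map.injective gridCoord_injective he ▸ hf, fun h ↦ ⟨e, h, rfl⟩⟩
  have hcount : (p.edges.map (Sym2.map gridCoord)).countP (· ∈ coordEdges S)
      = (p.edges.filter (· ∈ S)).toFinset.card := by
    rw [List.toFinset_card_of_nodup (hnd.filter _), List.countP_map, List.countP_eq_length_filter]
    congr 2
    funext e
    simp [hmem]
  rw [hcount]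
  by_contra! hlt
  obtain ⟨e, he, f, hf, g, hg, h₁, h₂, h₃⟩ := Finset.two_lt_card.1 hlt
  simp only [List.mem_toFinset, List.mem_filter, decide_eq_true_eq] at he hf hg
  exact hS.2 u v p hp ⟨e, he.2, f, hf.2, g, hg.2, h₁, h₂, h₃, he.1, hf.1, hg.1⟩

lemma IsEdgeGeneralPosition.card_le_sum {r s : ℕ} {S : Finset (Sym2 (Fin r × Fin s))}
    (hS : (grid r s).IsEdgeGeneralPosition S) :
    S.card ≤ ∑ j ∈ Finset.range s, rowCount (coordEdges S) j 0 (r - 1) +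
      ∑ i ∈ Finset.range r, colCount (coordEdges S) i 0 (s - 1) := by
  classical
  have hcard : S.card = (coordEdges S).card :=
    (Finset.card_image_of_injective _ (Sym2.map.injective gridCoord_injective)).symm
  set T := coordEdges S with hT
  set A := (Finset.range s ×ˢ Finset.range (r - 1)).filter
    fun x ↦ s((x.2, x.1), (x.2 + 1, x.1)) ∈ T with hA
  set B := (Finset.range r ×ˢ Finset.range (s - 1)).filter
    fun x ↦ s((x.1, x.2), (x.1, x.2 + 1)) ∈ T with hB
  have hsub : T ⊆ A.image (fun x ↦ s((x.2, x.1), (x.2 + 1, x.1))) ∪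
      B.image (fun x ↦ s((x.1, x.2), (x.1, x.2 + 1))) := by
    intro e he
    have he' := he
    rw [hT, coordEdges, Finset.mem_image] at he'
    obtain ⟨f, hf, rfl⟩ := he'
    have hadj := hS.1 f hf
    induction f using Sym2.ind with
    | _ u v =>
      rw [mem_edgeSet, grid_adj] at hadj
      rw [Sym2.map_mk] at he ⊢
      have hu₁ := u.1.2
      have hu₂ := u.2.2
      have hv₁ := v.1.2
      have hv₂ := v.2.2
      simp only [gridCoord] at he ⊢
      rw [Finset.mem_union, Finset.mem_image, Finset.mem_image]
      rcases hadj with ⟨h | h, h'⟩ | ⟨h | h, h'⟩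
      · rw [← h', ← h] at he ⊢
        exact .inl ⟨(u.2, u.1), by simp [hA, he]; omega, rfl⟩
      · rw [h', ← h, Sym2.eq_swap] at he ⊢
        exact .inl ⟨(v.2, v.1), by simp [hA, he]; omega, rfl⟩
      · rw [← h', ← h] at he ⊢
        exact .inr ⟨(u.1, u.2), by simp [hB, he]; omega, rfl⟩
      · rw [h', ← h, Sym2.eq_swap] at he ⊢
        exact .inr ⟨(v.1, v.2), by simp [hB, he]; omega, rfl⟩
  have hA' : ∑ j ∈ Finset.range s, rowCount T j 0 (r - 1) = A.card := by
    simp only [rowCount, hA, Finset.card_filter, Finset.sum_product, Finset.range_eq_Ico]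
  have hB' : ∑ i ∈ Finset.range r, colCount T i 0 (s - 1) = B.card := by
    simp only [colCount, hB, Finset.card_filter, Finset.sum_product, Finset.range_eq_Ico]
  rw [hcard, hA', hB']
  exact (Finset.card_le_card hsub).trans ((Finset.card_union_le _ _).trans
    (add_le_add Finset.card_image_le Finset.card_image_le))

end SimpleGraph

/-! ### Upper bounds from staircases -/

namespace SimpleGraph

namespace IsEdgeGeneralPosition

section Staircase

variable {r s : ℕ} {S : Finset (Sym2 (Fin r × Fin s))} {x₀ x₁ x₂ y₀ y₁ y₂ : ℕ}

lemma right_up_right_up_le (hS : (grid r s).IsEdgeGeneralPosition S) (hx : x₀ ≤ x₁)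
    (hx' : x₁ ≤ x₂) (hr : x₂ < r) (hy : y₀ ≤ y₁) (hy' : y₁ ≤ y₂) (hs : y₂ < s) :
    rowCount (coordEdges S) y₀ x₀ x₁ + colCount (coordEdges S) x₁ y₀ y₁ +
      rowCount (coordEdges S) y₁ x₁ x₂ + colCount (coordEdges S) x₂ y₁ y₂ ≤ 2 := by
  apply hS.route_le_two (a := (x₀, y₀)) (b := (x₂, y₂))
  refine (((GridRoute.right (by omega) (by omega) hx).append
    (GridRoute.up (by omega) (by omega) hy) ?_).append
    (GridRoute.right (by omega) (by omega) hx') ?_).append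
    (GridRoute.up (by omega) (by omega) hy') ?_ <;> simp only [taxicabDist] <;> omega

lemma up_right_up_right_le (hS : (grid r s).IsEdgeGeneralPosition S) (hx : x₀ ≤ x₁)
    (hx' : x₁ ≤ x₂) (hr : x₂ < r) (hy : y₀ ≤ y₁) (hy' : y₁ ≤ y₂) (hs : y₂ < s) :
    colCount (coordEdges S) x₀ y₀ y₁ + rowCount (coordEdges S) y₁ x₀ x₁ +
      colCount (coordEdges S) x₁ y₁ y₂ + rowCount (coordEdges S) y₂ x₁ x₂ ≤ 2 := by
  apply hS.route_le_two (a := (x₀, y₀)) (b := (x₂, y₂))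
  refine (((GridRoute.up (by omega) (by omega) hy).append
    (GridRoute.right (by omega) (by omega) hx) ?_).append
    (GridRoute.up (by omega) (by omega) hy') ?_).append
    (GridRoute.right (by omega) (by omega) hx') ?_ <;> simp only [taxicabDist] <;> omega

lemma right_down_right_down_le (hS : (grid r s).IsEdgeGeneralPosition S) (hx : x₀ ≤ x₁)
    (hx' : x₁ ≤ x₂) (hr : x₂ < r) (hy : y₀ ≤ y₁) (hy' : y₁ ≤ y₂) (hs : y₂ < s) :
    rowCount (coordEdges S) y₂ x₀ x₁ + colCount (coordEdges S) x₁ y₁ y₂ +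
      rowCount (coordEdges S) y₁ x₁ x₂ + colCount (coordEdges S) x₂ y₀ y₁ ≤ 2 := by
  apply hS.route_le_two (a := (x₀, y₂)) (b := (x₂, y₀))
  refine (((GridRoute.right (by omega) (by omega) hx).append
    (GridRoute.down (by omega) (by omega) hy') ?_).append
    (GridRoute.right (by omega) (by omega) hx') ?_).append
    (GridRoute.down (by omega) (by omega) hy) ?_ <;> simp only [taxicabDist] <;> omega

lemma down_right_down_right_le (hS : (grid r s).IsEdgeGeneralPosition S) (hx : x₀ ≤ x₁)
    (hx' : x₁ ≤ x₂) (hr : x₂ < r) (hy : y₀ ≤ y₁) (hy' : y₁ ≤ y₂) (hs : y₂ < s) :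
    colCount (coordEdges S) x₀ y₁ y₂ + rowCount (coordEdges S) y₁ x₀ x₁ +
      colCount (coordEdges S) x₁ y₀ y₁ + rowCount (coordEdges S) y₀ x₁ x₂ ≤ 2 := by
  apply hS.route_le_two (a := (x₀, y₂)) (b := (x₂, y₀))
  refine (((GridRoute.down (by omega) (by omega) hy').append
    (GridRoute.right (by omega) (by omega) hx) ?_).append
    (GridRoute.down (by omega) (by omega) hy) ?_).append
    (GridRoute.right (by omega) (by omega) hx') ?_ <;> simp only [taxicabDist] <;> omega

end Staircase

lemma card_le_of_two_rows {m : ℕ} {S : Finset (Sym2 (Fin (m + 2) × Fin 2))}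
    (hS : (grid (m + 2) 2).IsEdgeGeneralPosition S) : S.card ≤ m + 4 := by
  have hcard := hS.card_le_sum
  set T := coordEdges S
  have hmid : ∑ i ∈ Finset.range m, colCount T (i + 1) 0 1 ≤ m := by
    refine (Finset.sum_le_card_nsmul _ _ 1 fun i _ ↦ ?_).trans (by simp)
    simp only [colCount, Nat.Ico_zero_eq_range, Finset.range_one,
      Finset.sum_singleton]
    split_ifs <;> simp
  -- The last two segments are empty: these two L-shaped routes together cover both rows and both
  -- end columns once.
  have h₁ := hS.right_up_right_up_le (x₀ := 0) (x₁ := m + 1) (x₂ := m + 1) (y₀ := 0) (y₁ := 1)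
    (y₂ := 1) (by omega) (by omega) (by omega) (by omega) (by omega) (by omega)
  have h₂ := hS.up_right_up_right_le (x₀ := 0) (x₁ := m + 1) (x₂ := m + 1) (y₀ := 0) (y₁ := 1)
    (y₂ := 1) (by omega) (by omega) (by omega) (by omega) (by omega) (by omega)
  rw [Finset.sum_range_succ _ (m + 1), Finset.sum_range_succ' _ m] at hcard
  simp only [Finset.sum_range_succ, Finset.sum_range_zero] at hcard
  change S.card ≤ 0 + rowCount T 0 0 (m + 1) + rowCount T 1 0 (m + 1) +
    (∑ i ∈ Finset.range m, colCount T (i + 1) 0 1 + colCount T 0 0 1 + colCount T (m + 1) 0 1) at hcard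
  linarith

lemma card_le_of_three_rows {m : ℕ} {S : Finset (Sym2 (Fin (m + 3) × Fin 3))}
    (hS : (grid (m + 3) 3).IsEdgeGeneralPosition S) : S.card ≤ 2 * (m + 3) := by
  have hcard := hS.card_le_sum
  set T := coordEdges S
  have hmid : ∑ i ∈ Finset.range m, colCount T (i + 2) 0 2 ≤ 2 * m := by
    refine (Finset.sum_le_card_nsmul _ _ 2 fun i hi ↦ ?_).trans (by simp [mul_comm])
    rw [Finset.mem_range] at hi
    exact hS.route_le_two (GridRoute.up (by omega) (by omega) (by omega))
  have hrow (j : ℕ) : rowCount T j 0 1 + rowCount T j 1 (m + 2) = rowCount T j 0 (m + 2) :=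
    rowCount_add T j (by omega) (by omega)
  have hcol (i : ℕ) : colCount T i 0 1 + colCount T i 1 2 = colCount T i 0 2 :=
    colCount_add T i (by omega) (by omega)
  -- The `l` routes cover the boundary twice; the `t` routes cover it once, and row 1 and column 1
  -- twice. With weights 1 and 2 every edge of these six lines is covered four times, so they carry
  -- at most (8 + 16) / 4 = 6 edges.
  have l₁ := hS.right_up_right_up_le (x₀ := 0) (x₁ := m + 2) (x₂ := m + 2) (y₀ := 0) (y₁ := 2)
    (y₂ := 2) (by omega) (by omega) (by omega) (by omega) (by omega) (by omega)
  have l₂ := hS.up_right_up_right_le (x₀ := 0) (x₁ := m + 2) (x₂ := m + 2) (y₀ := 0) (y₁ := 2)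
    (y₂ := 2) (by omega) (by omega) (by omega) (by omega) (by omega) (by omega)
  have l₃ := hS.right_down_right_down_le (x₀ := 0) (x₁ := m + 2) (x₂ := m + 2) (y₀ := 0)
    (y₁ := 0) (y₂ := 2) (by omega) (by omega) (by omega) (by omega) (by omega) (by omega)
  have l₄ := hS.down_right_down_right_le (x₀ := 0) (x₁ := m + 2) (x₂ := m + 2) (y₀ := 0)
    (y₁ := 0) (y₂ := 2) (by omega) (by omega) (by omega) (by omega) (by omega) (by omega)
  have t₁ := hS.right_up_right_up_le (x₀ := 0) (x₁ := 1) (x₂ := m + 2) (y₀ := 0) (y₁ := 1)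
    (y₂ := 2) (by omega) (by omega) (by omega) (by omega) (by omega) (by omega)
  have t₂ := hS.up_right_up_right_le (x₀ := 0) (x₁ := 1) (x₂ := m + 2) (y₀ := 0) (y₁ := 1)
    (y₂ := 2) (by omega) (by omega) (by omega) (by omega) (by omega) (by omega)
  have t₃ := hS.right_down_right_down_le (x₀ := 0) (x₁ := 1) (x₂ := m + 2) (y₀ := 0)
    (y₁ := 1) (y₂ := 2) (by omega) (by omega) (by omega) (by omega) (by omega) (by omega)
  have t₄ := hS.down_right_down_right_le (x₀ := 0) (x₁ := 1) (x₂ := m + 2) (y₀ := 0)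
    (y₁ := 1) (y₂ := 2) (by omega) (by omega) (by omega) (by omega) (by omega) (by omega)
  rw [Finset.sum_range_succ _ (m + 2), Finset.sum_range_succ' _ (m + 1),
    Finset.sum_range_succ' _ m] at hcard
  simp only [Finset.sum_range_succ, Finset.sum_range_zero] at hcard
  change S.card ≤ 0 + rowCount T 0 0 (m + 2) + rowCount T 1 0 (m + 2) + rowCount T 2 0 (m + 2) +
    (∑ i ∈ Finset.range m, colCount T (i + 2) 0 2 + colCount T 1 0 2 + colCount T 0 0 2 +
      colCount T (m + 2) 0 2) at hcard
  linarith [hrow 0, hrow 1, hrow 2, hcol 0, hcol 1, hcol (m + 2)]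

lemma card_le_of_four_le {m n : ℕ} {S : Finset (Sym2 (Fin (m + 4) × Fin (n + 4)))}
    (hS : (grid (m + 4) (n + 4)).IsEdgeGeneralPosition S) : S.card ≤ 2 * m + 2 * n + 8 := by
  have hcard := hS.card_le_sum
  set T := coordEdges S
  have hmid : ∑ i ∈ Finset.range m, colCount T (i + 2) 0 (n + 3) ≤ 2 * m := by
    refine (Finset.sum_le_card_nsmul _ _ 2 fun i hi ↦ ?_).trans (by simp [mul_comm])
    rw [Finset.mem_range] at hi
    exact hS.route_le_two (GridRoute.up (by omega) (by omega) (by omega))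
  have hmid' : ∑ j ∈ Finset.range n, rowCount T (j + 2) 0 (m + 3) ≤ 2 * n := by
    refine (Finset.sum_le_card_nsmul _ _ 2 fun i hi ↦ ?_).trans (by simp [mul_comm])
    rw [Finset.mem_range] at hi
    exact hS.route_le_two (GridRoute.right (by omega) (by omega) (by omega))
  have hrow (j : ℕ) : rowCount T j 0 1 + rowCount T j 1 (m + 3) = rowCount T j 0 (m + 3) :=
    rowCount_add T j (by omega) (by omega)
  have hrow' (j : ℕ) : rowCount T j 0 (m + 2) + rowCount T j (m + 2) (m + 3) =
      rowCount T j 0 (m + 3) := rowCount_add T j (by omega) (by omega)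
  have hcol (i : ℕ) : colCount T i 0 1 + colCount T i 1 (n + 3) = colCount T i 0 (n + 3) :=
    colCount_add T i (by omega) (by omega)
  have hcol' (i : ℕ) : colCount T i 0 (n + 2) + colCount T i (n + 2) (n + 3) =
      colCount T i 0 (n + 3) := colCount_add T i (by omega) (by omega)
  -- The eight staircases cover each edge of the two outermost rows and columns on every side
  -- exactly twice, so these eight lines carry at most 16 / 2 = 8 edges.
  have p₁ := hS.right_up_right_up_le (x₀ := 0) (x₁ := 1) (x₂ := m + 3) (y₀ := 0) (y₁ := n + 2)
    (y₂ := n + 3) (by omega) (by omega) (by omega) (by omega) (by omega) (by omega)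
  have p₂ := hS.up_right_up_right_le (x₀ := 0) (x₁ := m + 2) (x₂ := m + 3) (y₀ := 0) (y₁ := 1)
    (y₂ := n + 3) (by omega) (by omega) (by omega) (by omega) (by omega) (by omega)
  have p₃ := hS.right_down_right_down_le (x₀ := 0) (x₁ := 1) (x₂ := m + 3) (y₀ := 0)
    (y₁ := 1) (y₂ := n + 3) (by omega) (by omega) (by omega) (by omega) (by omega) (by omega)
  have p₄ := hS.down_right_down_right_le (x₀ := 0) (x₁ := m + 2) (x₂ := m + 3) (y₀ := 0)
    (y₁ := n + 2) (y₂ := n + 3) (by omega) (by omega) (by omega) (by omega) (by omega) (by omega)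
  have q₁ := hS.right_up_right_up_le (x₀ := 0) (x₁ := m + 2) (x₂ := m + 3) (y₀ := 0) (y₁ := 1)
    (y₂ := n + 3) (by omega) (by omega) (by omega) (by omega) (by omega) (by omega)
  have q₂ := hS.up_right_up_right_le (x₀ := 0) (x₁ := 1) (x₂ := m + 3) (y₀ := 0) (y₁ := n + 2)
    (y₂ := n + 3) (by omega) (by omega) (by omega) (by omega) (by omega) (by omega)
  have q₃ := hS.right_down_right_down_le (x₀ := 0) (x₁ := m + 2) (x₂ := m + 3) (y₀ := 0)
    (y₁ := n + 2) (y₂ := n + 3) (by omega) (by omega) (by omega) (by omega) (by omega) (by omega)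
  have q₄ := hS.down_right_down_right_le (x₀ := 0) (x₁ := 1) (x₂ := m + 3) (y₀ := 0)
    (y₁ := 1) (y₂ := n + 3) (by omega) (by omega) (by omega) (by omega) (by omega) (by omega)
  rw [Finset.sum_range_succ _ (m + 3), Finset.sum_range_succ _ (m + 2),
    Finset.sum_range_succ' _ (m + 1), Finset.sum_range_succ' _ m,
    Finset.sum_range_succ _ (n + 3), Finset.sum_range_succ _ (n + 2),
    Finset.sum_range_succ' _ (n + 1), Finset.sum_range_succ' _ n] at hcard
  change S.card ≤ ∑ j ∈ Finset.range n, rowCount T (j + 2) 0 (m + 3) + rowCount T 1 0 (m + 3) +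
    rowCount T 0 0 (m + 3) + rowCount T (n + 2) 0 (m + 3) + rowCount T (n + 3) 0 (m + 3) +
    (∑ i ∈ Finset.range m, colCount T (i + 2) 0 (n + 3) + colCount T 1 0 (n + 3) +
      colCount T 0 0 (n + 3) + colCount T (m + 2) 0 (n + 3) + colCount T (m + 3) 0 (n + 3)) at hcard
  linarith [hrow 0, hrow 1, hrow (n + 2), hrow (n + 3), hrow' 0, hrow' 1, hrow' (n + 2),
    hrow' (n + 3), hcol 0, hcol 1, hcol (m + 2), hcol (m + 3), hcol' 0, hcol' 1, hcol' (m + 2),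
    hcol' (m + 3)]

end IsEdgeGeneralPosition

end SimpleGraph

/-! ### Lower bounds from potentials -/

namespace SimpleGraph

/-- If `Φ` is nondecreasing along the steps of geodesics towards `v` from vertices satisfying `P`,
and every edge of `S` changes `Φ`, then the number of edges of `S` on a geodesic to `v` is at most
the increment of `Φ`. -/
lemma add_countP_le_of_potential {r s : ℕ} (S : Finset (Sym2 (Fin r × Fin s))) (v : Fin r × Fin s)
    (Φ : Fin r × Fin s → ℕ) (P : Fin r × Fin s → Prop)
    (hstep : ∀ a b, (grid r s).Adj a b → P a →
      taxicabDist (gridCoord a) (gridCoord v) = taxicabDist (gridCoord b) (gridCoord v) + 1 →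
      P b ∧ Φ a ≤ Φ b)
    (hS : ∀ a b, s(a, b) ∈ S → Φ a ≠ Φ b) {u : Fin r × Fin s} (p : (grid r s).Walk u v)
    (hp : p.length = taxicabDist (gridCoord u) (gridCoord v)) (hu : P u) :
    Φ u + p.edges.countP (· ∈ S) ≤ Φ v := by
  induction p with
  | nil => simp
  | @cons a b c h p ih =>
    -- Together with `hd` and `hp`, this forces the first step to decrease the distance to the end
    -- by exactly 1.
    have hle := taxicabDist_le_length p
    have hd : taxicabDist (gridCoord a) (gridCoord c)
        ≤ taxicabDist (gridCoord b) (gridCoord c) + 1 := by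
      have h' := grid_adj.1 h
      simp only [taxicabDist, gridCoord]
      omega
    rw [Walk.length_cons] at hp
    obtain ⟨hb, hab⟩ := hstep a b h hu (by omega)
    have := ih hstep (by omega) hb
    rw [Walk.edges_cons, List.countP_cons]
    by_cases hm : s(a, b) ∈ S
    · have := hS a b hm
      simp only [hm, decide_true, if_true]
      omega
    · simp only [hm, decide_false, Bool.false_eq_true, if_false]
      omega

/-- A set of edges of the grid is in edge general position if there are two functions with values
in `{0, 1, 2}`, one monotone in both coordinates and one monotone in the first and antitone in the
second, both changing along each edge of the set. -/
lemma isEdgeGeneralPosition_of_potentials {r s : ℕ} (S : Finset (Sym2 (Fin r × Fin s)))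
    (Φ Ψ : ℕ → ℕ → ℕ) (hΦ : ∀ x y x' y', x ≤ x' → y ≤ y' → Φ x y ≤ Φ x' y')
    (hΨ : ∀ x y x' y', x ≤ x' → y' ≤ y → Ψ x y ≤ Ψ x' y')
    (hΦ₂ : ∀ x y, Φ x y ≤ 2) (hΨ₂ : ∀ x y, Ψ x y ≤ 2)
    (hedge : ∀ e ∈ S, e ∈ (grid r s).edgeSet)
    (hSΦ : ∀ a b, s(a, b) ∈ S → Φ a.1 a.2 ≠ Φ b.1 b.2)
    (hSΨ : ∀ a b, s(a, b) ∈ S → Ψ a.1 a.2 ≠ Ψ b.1 b.2) :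
    (grid r s).IsEdgeGeneralPosition S := by
  classical
  have key : ∀ (u v : Fin r × Fin s) (p : (grid r s).Walk u v), p.IsGeodesic → u.1 ≤ v.1 →
      p.edges.countP (· ∈ S) ≤ 2 := by
    intro u v p hp huv
    rw [Walk.IsGeodesic, grid_dist] at hp
    rcases le_total u.2 v.2 with h | h
    · have := add_countP_le_of_potential S v (fun a ↦ Φ a.1 a.2)
        (fun a ↦ a.1 ≤ v.1 ∧ a.2 ≤ v.2) ?_ hSΦ p hp ⟨huv, h⟩
      · have := hΦ₂ v.1 v.2
        omega
      · intro a b hab ha hd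
        rw [grid_adj] at hab
        simp only [taxicabDist, gridCoord, Fin.le_def] at hd ha ⊢
        exact ⟨by omega, hΦ _ _ _ _ (by omega) (by omega)⟩
    · have := add_countP_le_of_potential S v (fun a ↦ Ψ a.1 a.2)
        (fun a ↦ a.1 ≤ v.1 ∧ v.2 ≤ a.2) ?_ hSΨ p hp ⟨huv, h⟩
      · have := hΨ₂ v.1 v.2
        omega
      · intro a b hab ha hd
        rw [grid_adj] at hab
        simp only [taxicabDist, gridCoord, Fin.le_def] at hd ha ⊢
        exact ⟨by omega, hΨ _ _ _ _ (by omega) (by omega)⟩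
  refine ⟨hedge, ?_⟩
  rintro u v p hp ⟨e, he, f, hf, g, hg, hef, heg, hfg, hep, hfp, hgp⟩
  have hcount : p.edges.countP (· ∈ S) ≤ 2 := by
    rcases le_total u.1 v.1 with h | h
    · exact key u v p hp h
    · have := key v u p.reverse (by rw [Walk.IsGeodesic, Walk.length_reverse, hp, dist_comm]) h
      rwa [Walk.edges_reverse, List.countP_reverse] at this
  have hlt : 2 < (p.edges.filter (· ∈ S)).toFinset.card :=
    Finset.two_lt_card.2 ⟨e, by simp [he, hep], f, by simp [hf, hfp], g, by simp [hg, hgp],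
      hef, heg, hfg⟩
  have := List.toFinset_card_le (p.edges.filter (· ∈ S))
  rw [List.countP_eq_length_filter] at hcount
  omega

/-- A set `A` of horizontal edges (given by their left ends) and a set `B` of vertical edges (given
by their lower ends) of the grid along which two potentials change form an edge general position
set. -/
lemma exists_isEdgeGeneralPosition_card {r s : ℕ} (A B : Finset (ℕ × ℕ))
    (hA : ∀ a ∈ A, a.1 + 1 < r ∧ a.2 < s) (hB : ∀ b ∈ B, b.1 < r ∧ b.2 + 1 < s)
    (Φ Ψ : ℕ → ℕ → ℕ) (hΦ : ∀ x y x' y', x ≤ x' → y ≤ y' → Φ x y ≤ Φ x' y')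
    (hΨ : ∀ x y x' y', x ≤ x' → y' ≤ y → Ψ x y ≤ Ψ x' y')
    (hΦ₂ : ∀ x y, Φ x y ≤ 2) (hΨ₂ : ∀ x y, Ψ x y ≤ 2)
    (hAΦ : ∀ a ∈ A, Φ a.1 a.2 ≠ Φ (a.1 + 1) a.2) (hAΨ : ∀ a ∈ A, Ψ a.1 a.2 ≠ Ψ (a.1 + 1) a.2)
    (hBΦ : ∀ b ∈ B, Φ b.1 b.2 ≠ Φ b.1 (b.2 + 1)) (hBΨ : ∀ b ∈ B, Ψ b.1 b.2 ≠ Ψ b.1 (b.2 + 1)) :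
    ∃ S : Finset (Sym2 (Fin r × Fin s)), (grid r s).IsEdgeGeneralPosition S ∧
      S.card = A.card + B.card := by
  classical
  let T : Finset (Sym2 (ℕ × ℕ)) :=
    A.image (fun a ↦ s(a, (a.1 + 1, a.2))) ∪ B.image (fun b ↦ s(b, (b.1, b.2 + 1)))
  have hTcard : T.card = A.card + B.card := by
    rw [Finset.card_union_of_disjoint, Finset.card_image_of_injective,
      Finset.card_image_of_injective]
    · rintro ⟨a, b⟩ ⟨c, d⟩ h
      simp only [Sym2.eq_iff, Prod.mk.injEq] at h ⊢
      omega
    · rintro ⟨a, b⟩ ⟨c, d⟩ h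
      simp only [Sym2.eq_iff, Prod.mk.injEq] at h ⊢
      omega
    · rw [Finset.disjoint_left]
      intro e he he'
      rw [Finset.mem_image] at he he'
      obtain ⟨⟨a, b⟩, -, rfl⟩ := he
      obtain ⟨⟨c, d⟩, -, h⟩ := he'
      simp only [Sym2.eq_iff, Prod.mk.injEq] at h
      omega
  let S : Finset (Sym2 (Fin r × Fin s)) := Finset.univ.filter fun e ↦ e.map gridCoord ∈ T
  -- The bounds `hA`, `hB` place every edge of `T` inside the grid, so none is lost in the pullback.
  have himage : S.image (Sym2.map gridCoord) = T := by
    ext e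
    simp only [S, Finset.mem_image, Finset.mem_filter, Finset.mem_univ, true_and]
    refine ⟨fun ⟨f, hf, h⟩ ↦ h ▸ hf, fun he ↦ ?_⟩
    have he' := he
    simp only [T, Finset.mem_union, Finset.mem_image] at he'
    rcases he' with ⟨a, ha, rfl⟩ | ⟨b, hb, rfl⟩
    · have := hA a ha
      exact ⟨s((⟨a.1, by omega⟩, ⟨a.2, by omega⟩), (⟨a.1 + 1, by omega⟩, ⟨a.2, by omega⟩)), he, rfl⟩
    · have := hB b hb
      exact ⟨s((⟨b.1, by omega⟩, ⟨b.2, by omega⟩), (⟨b.1, by omega⟩, ⟨b.2 + 1, by omega⟩)), he, rfl⟩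
  have hmem (u v : Fin r × Fin s) (h : s(u, v) ∈ S) :
      (∃ a ∈ A, (a = gridCoord u ∧ (a.1 + 1, a.2) = gridCoord v) ∨
        (a = gridCoord v ∧ (a.1 + 1, a.2) = gridCoord u)) ∨
      (∃ b ∈ B, (b = gridCoord u ∧ (b.1, b.2 + 1) = gridCoord v) ∨
        (b = gridCoord v ∧ (b.1, b.2 + 1) = gridCoord u)) := by
    simpa [S, T] using h
  have hchange (Θ : ℕ → ℕ → ℕ) (h₁ : ∀ a ∈ A, Θ a.1 a.2 ≠ Θ (a.1 + 1) a.2)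
      (h₂ : ∀ b ∈ B, Θ b.1 b.2 ≠ Θ b.1 (b.2 + 1)) (u v : Fin r × Fin s) (h : s(u, v) ∈ S) :
      Θ u.1 u.2 ≠ Θ v.1 v.2 := by
    rcases hmem u v h with ⟨⟨a, b⟩, hab, h | h⟩ | ⟨⟨a, b⟩, hab, h | h⟩ <;>
      simp only [gridCoord, Prod.mk.injEq] at h <;> obtain ⟨⟨e₁, e₂⟩, e₃, e₄⟩ := h
    · rw [← e₃, ← e₄, ← e₁, ← e₂]
      exact h₁ _ hab
    · rw [← e₃, ← e₄, ← e₁, ← e₂]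
      exact (h₁ _ hab).symm
    · rw [← e₃, ← e₄, ← e₁, ← e₂]
      exact h₂ _ hab
    · rw [← e₃, ← e₄, ← e₁, ← e₂]
      exact (h₂ _ hab).symm
  refine ⟨S, isEdgeGeneralPosition_of_potentials S Φ Ψ hΦ hΨ hΦ₂ hΨ₂ ?_ (hchange Φ hAΦ hBΦ)
    (hchange Ψ hAΨ hBΨ), ?_⟩
  · intro e he
    induction e using Sym2.ind with
    | _ u v =>
      rw [mem_edgeSet, grid_adj]
      rcases hmem u v he with ⟨⟨a, b⟩, hab, h | h⟩ | ⟨⟨a, b⟩, hab, h | h⟩ <;>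
        simp only [gridCoord, Prod.mk.injEq] at h <;> omega
  · rw [← hTcard, ← himage,
      Finset.card_image_of_injective _ (Sym2.map.injective gridCoord_injective)]

/-- All rungs, plus the leftmost edge of each row. -/
lemma exists_isEdgeGeneralPosition_two_rows (m : ℕ) :
    ∃ S : Finset (Sym2 (Fin (m + 2) × Fin 2)), (grid (m + 2) 2).IsEdgeGeneralPosition S ∧
      S.card = m + 4 := by
  obtain ⟨S, hS, hcard⟩ := exists_isEdgeGeneralPosition_card (r := m + 2) (s := 2)
    ({0} ×ˢ {0, 1}) (Finset.range (m + 2) ×ˢ {0}) (by simp) (by simp)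
    (fun x y ↦ min x 1 + min y 1) (fun x y ↦ min x 1 + (1 - y))
    (by intros; omega) (by intros; omega)
    (by intros; omega) (by intros; omega)
    (by simp) (by simp) (by simp) (by simp)
  exact ⟨S, hS, by rw [hcard]; simp; omega⟩

/-- All vertical edges: the height itself serves as potential. -/
lemma exists_isEdgeGeneralPosition_three_rows (r : ℕ) :
    ∃ S : Finset (Sym2 (Fin r × Fin 3)), (grid r 3).IsEdgeGeneralPosition S ∧
      S.card = 2 * r := by
  obtain ⟨S, hS, hcard⟩ := exists_isEdgeGeneralPosition_card (r := r) (s := 3)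
    ∅ (Finset.range r ×ˢ {0, 1}) (by simp) (by simp; omega)
    (fun _ y ↦ min y 2) (fun _ y ↦ 2 - y)
    (by intros; omega) (by intros; omega)
    (by intros; omega) (by intros; omega)
    (by simp) (by simp) (by simp; omega) (by simp; omega)
  exact ⟨S, hS, by rw [hcard]; simp; omega⟩

/-- The edges joining a boundary vertex to an interior one. Φ increases on entering the interior
from the left or bottom and on leaving it by the right or top; Ψ is Φ reflected vertically. -/
lemma exists_isEdgeGeneralPosition_four_le (m n : ℕ) :
    ∃ S : Finset (Sym2 (Fin (m + 4) × Fin (n + 4))),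
      (grid (m + 4) (n + 4)).IsEdgeGeneralPosition S ∧ S.card = 2 * m + 2 * n + 8 := by
  have key := exists_isEdgeGeneralPosition_card (r := m + 4) (s := n + 4)
    ({0, m + 2} ×ˢ Finset.Icc 1 (n + 2)) (Finset.Icc 1 (m + 2) ×ˢ {0, n + 2})
    (by simp; omega) (by simp; omega)
    (fun x y ↦ (if 1 ≤ x ∧ 1 ≤ y then 1 else 0) + if m + 3 ≤ x ∨ n + 3 ≤ y then 1 else 0)
    (fun x y ↦ (if 1 ≤ x ∧ y ≤ n + 2 then 1 else 0) + if m + 3 ≤ x ∨ y < 1 then 1 else 0)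
    (by intros; split_ifs <;> omega) (by intros; split_ifs <;> omega)
    (by intros; split_ifs <;> omega) (by intros; split_ifs <;> omega)
    ?_ ?_ ?_ ?_
  · obtain ⟨S, hS, hcard⟩ := key
    exact ⟨S, hS, by rw [hcard]; simp; omega⟩
  all_goals
    rintro ⟨a, b⟩ h
    simp only [Finset.mem_product, Finset.mem_insert, Finset.mem_singleton, Finset.mem_Icc] at h
    dsimp only
    split_ifs <;> omega

end SimpleGraph

namespace SimpleGraph

lemma edgeGeneralPositionNumber_eq {V : Type*} [Finite V] {G : SimpleGraph V} {n : ℕ}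
    (hex : ∃ S : Finset (Sym2 V), G.IsEdgeGeneralPosition S ∧ S.card = n)
    (hle : ∀ S : Finset (Sym2 V), G.IsEdgeGeneralPosition S → S.card ≤ n) :
    G.edgeGeneralPositionNumber = n :=
  IsGreatest.csSup_eq ⟨hex, by rintro _ ⟨S, hS, rfl⟩; exact hle S hS⟩

end SimpleGraph

theorem theorem3p2 (r s : ℕ) (hs : 2 ≤ s) (hrs : s ≤ r) :
    (s = 2 → (SimpleGraph.boxProd (SimpleGraph.pathGraph r)
        (SimpleGraph.pathGraph s)).edgeGeneralPositionNumber = r + 2) ∧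
    (s = 3 → (SimpleGraph.boxProd (SimpleGraph.pathGraph r)
        (SimpleGraph.pathGraph s)).edgeGeneralPositionNumber = 2 * r) ∧
    (4 ≤ s → (SimpleGraph.boxProd (SimpleGraph.pathGraph r)
        (SimpleGraph.pathGraph s)).edgeGeneralPositionNumber = 2 * r + 2 * s - 8) := by
  refine ⟨?_, ?_, fun h ↦ ?_⟩
  · rintro rfl
    obtain ⟨m, rfl⟩ := Nat.exists_eq_add_of_le' hrs
    exact SimpleGraph.edgeGeneralPositionNumber_eq
      (SimpleGraph.exists_isEdgeGeneralPosition_two_rows m) fun _ hS ↦ hS.card_le_of_two_rows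
  · rintro rfl
    obtain ⟨m, rfl⟩ := Nat.exists_eq_add_of_le' hrs
    exact SimpleGraph.edgeGeneralPositionNumber_eq
      (SimpleGraph.exists_isEdgeGeneralPosition_three_rows _) fun _ hS ↦ hS.card_le_of_three_rows
  · obtain ⟨n, rfl⟩ := Nat.exists_eq_add_of_le' h
    obtain ⟨m, rfl⟩ := Nat.exists_eq_add_of_le' (h.trans hrs)
    rw [show 2 * (m + 4) + 2 * (n + 4) - 8 = 2 * m + 2 * n + 8 by omega]
    exact SimpleGraph.edgeGeneralPositionNumber_eq
      (SimpleGraph.exists_isEdgeGeneralPosition_four_le m n) fun _ hS ↦ hS.card_le_of_four_le
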